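/- **Theorem 3.9.** Let $N$ be a finite non-empty set and let $k, m \ge 1$ be integers. Let $\mathcal C = (C_i)_{i<m}$ be a sequence of subsets of $N$ that is a $k$-cover of $N$, i.e. each $j \in N$ satisfies $|\{ i < m : j \in C_i \}| \ge k$. Let $w = (w_i)_{i<m}$ be a sequence of non-negative reals, and write $\|w\|_2^2 = \sum_{i<m} w_i^2$. Let $(\Omega_j,\mu_j)_{j\in N}$ be a family of standard Borel probability spaces, and let $\mathbb P = \bigotimes_{j\in N} \mu_j$ be the product measure on $\prod_{j \in N} \Omega_j$. For $x,y \in \prod_{j\in N}\Omega_j$ put $$ d_{\mathcal C,w}(x,y) = \inf\Big\{ \sum_{i\in I} w_i \;:\; I \subseteq \{0,\dots,m-1\},\ \{ j\in N : x_j \ne y_j\} \subseteq \bigcup_{i\in I} C_i \Big\}. $$ Let $f\colon \prod_{j\in N}\Omega_j \to \mathbb R$ be measurable and $1$-Lipschitz with respect to the pseudo-metric $d_{\mathcal C,w}$, i.e. $|f(x)-f(y)| \le d_{\mathcal C,w}(x,y)$ for all $x,y$. Then $f$ is $\mathbb P$-integrable and, for every real $r>0$, $$ \mathbb P\big(\{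 x : f(x) - \mathbb E_{\mathbb P}(f) \ge r \}\big) \;\le\; \exp\!\Big( -\frac{k r^2}{4\|w\|_2^2} \Big), $$ where for $w = 0$ the right-hand side is read as $0$. -/

import Mathlib

/-- A finite sequence `C` of subsets of `N` is a `k`-cover of `N` if each element of `N` belongs to
at least `k` entries of the sequence (entries are counted with repetition). -/
def IsKCover {N : Type*} {m : ℕ} (k : ℕ) (C : Fin m → Set N) : Prop :=
  ∀ j : N, k ≤ {i : Fin m | j ∈ C i}.ncard

/-- The covering pseudo-metric `d_{C,w}` on a product: the infimum of `∑ i ∈ I, w i` over all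
`I ⊆ {0, …, m-1}` such that the sets `C i`, `i ∈ I`, cover all the coordinates where `x` and `y`
differ. (If `C` is a cover and `w` is non-negative, the set below is non-empty and bounded below.) -/
noncomputable def coveringDist {N : Type*} {m : ℕ} (C : Fin m → Set N) (w : Fin m → ℝ)
    {Ω : N → Type*} (x y : ∀ j, Ω j) : ℝ :=
  sInf {s : ℝ | ∃ I : Finset (Fin m), {j : N | x j ≠ y j} ⊆ ⋃ i ∈ I, C i ∧ s = ∑ i ∈ I, w i}

/-!
The proof is the entropy method, with a Shearer inequality for entropy in place of tensorization.

Write `E_A` for averaging over the coordinates in `A` (`coordAverage`). These operators satisfy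
`E_A E_B = E_{A ∪ B}`. For a positive `F` put `h A = ∫ φ (E_A F)` with `φ t = t log t`
(`averageEntropy`), so that `h ∅ - h A` is the mean entropy of `F` over the coordinates in `A`.
The set function `h` is decreasing and supermodular (`averageEntropy_anti`,
`averageEntropy_supermodular`); both follow from `a log (a / b) ≥ a - b`. Hence a `k`-cover
satisfies `k * Ent F ≤ ∑ i, (h ∅ - h (C i))` (`IsKCover.mul_sub_le_sum`).

Take `F = exp (t f)`. Points that differ only in `C i` are at distance at most `w i`, so over the
block `C i` the function `t f` oscillates by at most `t * w i`, and the block entropy is at most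
`(t * w i) ^ 2 / 2 * E F` (`averageEntropy_exp_sub_le`). Together,
`Ent F ≤ t ^ 2 * V / 2 * E F` with `V = ∑ i, w i ^ 2 / k`. Herbst's argument
(`cgf_le_of_entropy_le`) integrates this to a bound on the cumulant generating function, and
Chernoff's bound gives the tail `exp (-(r ^ 2 / (2 * V)))`, which is at most the bound claimed.
Integrability is clear, as the covering pseudo-metric, hence `f`, is bounded.
-/

open MeasureTheory ProbabilityTheory Filter Topology

/-! ### Bounded measurable functions -/

/-- Bounded measurable real functions. -/
def IsBddMeas {X : Type*} [MeasurableSpace X] (F : X → ℝ) : Prop :=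
  Measurable F ∧ ∃ K, ∀ x, |F x| ≤ K

/-- Measurable functions bounded above, and bounded below by a positive constant. -/
def IsPosBddMeas {X : Type*} [MeasurableSpace X] (F : X → ℝ) : Prop :=
  Measurable F ∧ ∃ a, 0 < a ∧ ∃ b, ∀ x, a ≤ F x ∧ F x ≤ b

section Bounded

variable {X : Type*} [MeasurableSpace X] {F G : X → ℝ}

lemma IsBddMeas.integrable (hF : IsBddMeas F) (P : Measure X) [IsFiniteMeasure P] :
    Integrable F P := by
  obtain ⟨hm, K, hK⟩ := hF
  exact Integrable.of_bound hm.aestronglyMeasurable K (ae_of_all _ hK)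

lemma IsBddMeas.mul (hF : IsBddMeas F) (hG : IsBddMeas G) :
    IsBddMeas (fun x => F x * G x) := by
  obtain ⟨hm, K, hK⟩ := hF
  obtain ⟨hm', K', hK'⟩ := hG
  refine ⟨hm.mul hm', K * K', fun x => ?_⟩
  rw [abs_mul]
  exact mul_le_mul (hK x) (hK' x) (abs_nonneg _) ((abs_nonneg _).trans (hK x))

lemma IsBddMeas.comp {Y : Type*} [MeasurableSpace Y] (hF : IsBddMeas F) {g : Y → X}
    (hg : Measurable g) : IsBddMeas (fun y => F (g y)) :=
  ⟨hF.1.comp hg, hF.2.imp fun _ h y => h (g y)⟩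

lemma IsPosBddMeas.pos (hF : IsPosBddMeas F) (x : X) : 0 < F x := by
  obtain ⟨-, a, ha, b, h⟩ := hF
  exact ha.trans_le (h x).1

lemma IsPosBddMeas.isBddMeas (hF : IsPosBddMeas F) : IsBddMeas F := by
  obtain ⟨hm, a, ha, b, h⟩ := hF
  exact ⟨hm, b, fun x => abs_le.2 ⟨by linarith [h x], (h x).2⟩⟩

lemma IsPosBddMeas.log (hF : IsPosBddMeas F) : IsBddMeas (fun x => Real.log (F x)) := by
  obtain ⟨hm, a, ha, b, h⟩ := hF
  refine ⟨hm.log, max |Real.log a| |Real.log b|, fun x => ?_⟩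
  exact abs_le_max_abs_abs (Real.log_le_log ha (h x).1)
    (Real.log_le_log (ha.trans_le (h x).1) (h x).2)

lemma IsPosBddMeas.inv (hF : IsPosBddMeas F) : IsBddMeas (fun x => (F x)⁻¹) := by
  obtain ⟨hm, a, ha, b, h⟩ := hF
  refine ⟨hm.inv, a⁻¹, fun x => ?_⟩
  have := ha.trans_le (h x).1
  rw [abs_of_pos (inv_pos.2 this)]
  exact inv_anti₀ ha (h x).1

lemma IsBddMeas.exp (hF : IsBddMeas F) : IsPosBddMeas (fun x => Real.exp (F x)) := by
  obtain ⟨hm, K, hK⟩ := hF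
  refine ⟨hm.exp, Real.exp (-K), Real.exp_pos _, Real.exp K, fun x => ?_⟩
  exact ⟨Real.exp_le_exp.2 (abs_le.1 (hK x)).1, Real.exp_le_exp.2 (abs_le.1 (hK x)).2⟩

end Bounded

/-! ### Averaging over a set of coordinates -/

section Average

variable {N : Type*} [Fintype N] {Ω : N → Type*} [∀ j, MeasurableSpace (Ω j)]
  (μ : ∀ j, Measure (Ω j))

open Classical in
/-- The average of `F` over the coordinates in `A`, the other coordinates being frozen. It is
encoded by resampling: a full independent copy `y` of the point is drawn, of which only the
coordinates in `A` are used. -/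
noncomputable def coordAverage (A : Set N) (F : (∀ j, Ω j) → ℝ) (x : ∀ j, Ω j) : ℝ :=
  ∫ y, F (A.piecewise y x) ∂(Measure.pi μ)

open Classical in
lemma measurable_piecewise_prod (A : Set N) :
    Measurable (fun p : (∀ j, Ω j) × (∀ j, Ω j) => A.piecewise p.2 p.1) := by
  refine measurable_pi_lambda _ fun j => ?_
  by_cases hj : j ∈ A
  · simp only [Set.piecewise_eq_of_mem _ _ _ hj]
    exact (measurable_pi_apply j).comp measurable_snd
  · simp only [Set.piecewise_eq_of_notMem _ _ _ hj]
    exact (measurable_pi_apply j).comp measurable_fst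

open Classical in
lemma measurable_piecewise_left (A : Set N) (x : ∀ j, Ω j) :
    Measurable (fun y : ∀ j, Ω j => A.piecewise y x) :=
  (measurable_piecewise_prod A).comp (measurable_const.prodMk measurable_id)

variable {F G : (∀ j, Ω j) → ℝ}

lemma coordAverage_univ (x : ∀ j, Ω j) :
    coordAverage μ Set.univ F x = ∫ y, F y ∂(Measure.pi μ) := by
  simp [coordAverage]

open Classical in
lemma coordAverage_piecewise {A B : Set N} (hAB : A ⊆ B) (x y : ∀ j, Ω j) :
    coordAverage μ B F (A.piecewise y x) = coordAverage μ B F x := by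
  refine integral_congr_ae (ae_of_all _ fun z => congrArg F (funext fun j => ?_))
  by_cases hB : j ∈ B
  · simp [hB]
  · have hA : j ∉ A := fun h => hB (hAB h)
    simp [hA, hB]

open Classical in
lemma coordAverage_mul_left {A : Set N} (hG : ∀ x y, G (A.piecewise y x) = G x) :
    coordAverage μ A (fun x => G x * F x) = fun x => G x * coordAverage μ A F x := by
  ext x
  simp only [coordAverage, hG]
  exact integral_const_mul _ _

variable [∀ j, IsProbabilityMeasure (μ j)]

open Classical in
lemma measurePreserving_piecewise (A : Set N) :
    MeasurePreserving (fun p : (∀ j, Ω j) × (∀ j, Ω j) => A.piecewise p.2 p.1)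
      ((Measure.pi μ).prod (Measure.pi μ)) (Measure.pi μ) := by
  refine ⟨measurable_piecewise_prod A, (Measure.pi_eq fun s hs => ?_).symm⟩
  rw [Measure.map_apply (measurable_piecewise_prod A) (MeasurableSet.univ_pi hs)]
  have hpre : (fun p : (∀ j, Ω j) × (∀ j, Ω j) => A.piecewise p.2 p.1) ⁻¹' Set.univ.pi s =
      (Set.univ.pi fun j => if j ∈ A then Set.univ else s j) ×ˢ
        (Set.univ.pi fun j => if j ∈ A then s j else Set.univ) := by
    ext p
    simp only [Set.mem_preimage, Set.mem_pi, Set.mem_univ, true_implies, Set.mem_prod,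
      ← forall_and]
    refine forall_congr' fun j => ?_
    by_cases hj : j ∈ A <;> simp [hj]
  rw [hpre, Measure.prod_prod, Measure.pi_pi, Measure.pi_pi, ← Finset.prod_mul_distrib]
  refine Finset.prod_congr rfl fun j _ => ?_
  by_cases hj : j ∈ A <;> simp [hj]

lemma IsBddMeas.measurable_coordAverage (hF : IsBddMeas F) (A : Set N) :
    Measurable (coordAverage μ A F) := by
  classical
  exact ((hF.1.comp (measurable_piecewise_prod A)).stronglyMeasurable.integral_prod_right'
    (ν := Measure.pi μ)).measurable

lemma IsPosBddMeas.coordAverage (hF : IsPosBddMeas F) (A : Set N) :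
    IsPosBddMeas (coordAverage μ A F) := by
  classical
  refine ⟨hF.isBddMeas.measurable_coordAverage μ A, ?_⟩
  have hI := fun x => (hF.isBddMeas.comp (measurable_piecewise_left A x)).integrable (Measure.pi μ)
  obtain ⟨hm, a, ha, b, h⟩ := hF
  refine ⟨a, ha, b, fun x => ⟨?_, ?_⟩⟩
  · simpa [_root_.coordAverage] using integral_mono (μ := Measure.pi μ) (integrable_const a) (hI x) fun y => (h _).1
  · simpa [_root_.coordAverage] using integral_mono (μ := Measure.pi μ) (hI x) (integrable_const b) fun y => (h _).2

@[simp] lemma coordAverage_empty : coordAverage μ ∅ F = F := by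
  ext x
  simp [coordAverage]

lemma integral_coordAverage (hF : IsBddMeas F) (A : Set N) :
    ∫ x, coordAverage μ A F x ∂(Measure.pi μ) = ∫ x, F x ∂(Measure.pi μ) := by
  classical
  have hI := (hF.comp (measurable_piecewise_prod A)).integrable
    ((Measure.pi μ).prod (Measure.pi μ))
  have h := integral_map (μ := (Measure.pi μ).prod (Measure.pi μ)) (f := F)
    (measurable_piecewise_prod A).aemeasurable hF.1.aestronglyMeasurable
  rw [(measurePreserving_piecewise μ A).map_eq] at h
  rw [h, integral_prod _ hI]
  rfl

lemma coordAverage_coordAverage (hF : IsBddMeas F) (A B : Set N) :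
    coordAverage μ A (coordAverage μ B F) = coordAverage μ (A ∪ B) F := by
  classical
  ext x
  have h := integral_coordAverage μ (hF.comp (measurable_piecewise_left (A ∪ B) x)) B
  rw [coordAverage, coordAverage, ← h]
  refine integral_congr_ae (ae_of_all _ fun y => integral_congr_ae (ae_of_all _ fun z => ?_))
  refine congrArg F (funext fun j => ?_)
  by_cases hB : j ∈ B <;> by_cases hA : j ∈ A <;> simp [Set.piecewise, hA, hB]

open Classical in
lemma integral_mul_coordAverage {A : Set N} (hF : IsBddMeas F) (hG : IsBddMeas G)
    (hinv : ∀ x y, G (A.piecewise y x) = G x) :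
    ∫ x, G x * coordAverage μ A F x ∂(Measure.pi μ) = ∫ x, G x * F x ∂(Measure.pi μ) := by
  rw [← integral_coordAverage μ (hG.mul hF) A, coordAverage_mul_left μ hinv]

/-! ### Entropy -/

lemma sub_le_mul_log_sub_log {a b : ℝ} (ha : 0 < a) (hb : 0 < b) :
    a - b ≤ a * (Real.log a - Real.log b) := by
  have h := Real.log_le_sub_one_of_pos (div_pos hb ha)
  rw [Real.log_div hb.ne' ha.ne'] at h
  have h2 := mul_le_mul_of_nonneg_left h ha.le
  have h3 : a * (b / a - 1) = b - a := by field_simp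
  linarith

/-- `∫ φ (E_A F)` with `φ t = t log t`, where `E_A` averages over the coordinates in `A`. -/
noncomputable def averageEntropy (F : (∀ j, Ω j) → ℝ) (A : Set N) : ℝ :=
  ∫ x, coordAverage μ A F x * Real.log (coordAverage μ A F x) ∂(Measure.pi μ)

/-- The outer average may be replaced by any finer one in front of the logarithm. -/
lemma averageEntropy_eq (hF : IsPosBddMeas F) {A B : Set N} (hAB : A ⊆ B) :
    averageEntropy μ F B =
      ∫ x, coordAverage μ A F x * Real.log (coordAverage μ B F x) ∂(Measure.pi μ) := by
  have h := integral_mul_coordAverage μ (A := B) (hF.coordAverage μ A).isBddMeas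
    (hF.coordAverage μ B).log
    (fun x y => by rw [coordAverage_piecewise μ subset_rfl])
  rw [coordAverage_coordAverage μ hF.isBddMeas, Set.union_eq_left.2 hAB] at h
  simpa only [averageEntropy, mul_comm] using h

lemma averageEntropy_anti (hF : IsPosBddMeas F) {A B : Set N} (hAB : A ⊆ B) :
    averageEntropy μ F B ≤ averageEntropy μ F A := by
  have hA := hF.coordAverage μ A
  have hB := hF.coordAverage μ B
  have i1 := (hA.isBddMeas.mul hA.log).integrable (Measure.pi μ)
  have i2 := (hA.isBddMeas.mul hB.log).integrable (Measure.pi μ)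
  have key := integral_mono (μ := Measure.pi μ)
    ((hA.isBddMeas.integrable _).sub (hB.isBddMeas.integrable _)) (i1.sub i2) fun x => by
      have := sub_le_mul_log_sub_log (hA.pos x) (hB.pos x)
      simp only [Pi.sub_apply]
      linarith
  simp only [Pi.sub_apply] at key
  rw [integral_sub (hA.isBddMeas.integrable _) (hB.isBddMeas.integrable _), integral_sub i1 i2,
    integral_coordAverage μ hF.isBddMeas, integral_coordAverage μ hF.isBddMeas, sub_self] at key
  rw [averageEntropy_eq μ hF hAB]
  exact sub_nonneg.1 key

/-- Supermodularity of `averageEntropy`. With `v, a, b, u` the averages of `F` over `A ∩ B`, `A`,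
`B`, `A ∪ B`, the defect is `∫ v log (v u / (a b))`, at least `∫ (v - a b / u)`; the latter vanishes
because `E_A (a b / u) = (a / u) E_A b = a`. -/
lemma averageEntropy_supermodular (hF : IsPosBddMeas F) (A B : Set N) :
    averageEntropy μ F A + averageEntropy μ F B ≤
      averageEntropy μ F (A ∩ B) + averageEntropy μ F (A ∪ B) := by
  have ha := hF.coordAverage μ A
  have hb := hF.coordAverage μ B
  have hu := hF.coordAverage μ (A ∪ B)
  have hv := hF.coordAverage μ (A ∩ B)
  have hq := (ha.isBddMeas.mul hu.inv).mul hb.isBddMeas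
  have i1 := (hv.isBddMeas.mul hv.log).integrable (Measure.pi μ)
  have i2 := (hv.isBddMeas.mul hu.log).integrable (Measure.pi μ)
  have i3 := (hv.isBddMeas.mul ha.log).integrable (Measure.pi μ)
  have i4 := (hv.isBddMeas.mul hb.log).integrable (Measure.pi μ)
  have hint : ∫ x, coordAverage μ A F x * (coordAverage μ (A ∪ B) F x)⁻¹ * coordAverage μ B F x
      ∂(Measure.pi μ) = ∫ x, F x ∂(Measure.pi μ) := by
    rw [← integral_mul_coordAverage μ (A := A) hb.isBddMeas (ha.isBddMeas.mul hu.inv)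
      (fun x y => by
        rw [coordAverage_piecewise μ subset_rfl, coordAverage_piecewise μ Set.subset_union_left]),
      coordAverage_coordAverage μ hF.isBddMeas, ← integral_coordAverage μ hF.isBddMeas A]
    refine integral_congr_ae (ae_of_all _ fun x => ?_)
    have := (hu.pos x).ne'
    field_simp
  have key := integral_mono (μ := Measure.pi μ)
    ((hv.isBddMeas.integrable _).sub (hq.integrable _)) ((i1.add i2).sub (i3.add i4)) fun x => by
      have h1 := ha.pos x
      have h2 := hu.pos x
      have h3 := hb.pos x
      have := sub_le_mul_log_sub_log (hv.pos x) (mul_pos (mul_pos h1 (inv_pos.2 h2)) h3)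
      rw [Real.log_mul (mul_pos h1 (inv_pos.2 h2)).ne' h3.ne',
        Real.log_mul h1.ne' (inv_pos.2 h2).ne', Real.log_inv] at this
      simp only [Pi.sub_apply, Pi.add_apply]
      linarith
  rw [integral_sub' (hv.isBddMeas.integrable _) (hq.integrable _),
    integral_sub' (i1.add i2) (i3.add i4), integral_add' i1 i2, integral_add' i3 i4,
    integral_coordAverage μ hF.isBddMeas, hint, sub_self,
    ← averageEntropy_eq μ hF Set.inter_subset_left,
    ← averageEntropy_eq μ hF Set.inter_subset_right,
    ← averageEntropy_eq μ hF (Set.inter_subset_left.trans Set.subset_union_left)] at key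
  have : averageEntropy μ F (A ∩ B) =
    ∫ x, coordAverage μ (A ∩ B) F x * Real.log (coordAverage μ (A ∩ B) F x) ∂(Measure.pi μ) := rfl
  linarith

/-- Shearer's inequality for a decreasing supermodular set function and a `k`-cover. -/
lemma IsKCover.mul_sub_le_sum {N : Type*} [Fintype N] {m k : ℕ} {C : Fin m → Set N}
    (hC : IsKCover k C) {h : Set N → ℝ} (hanti : ∀ A B, A ⊆ B → h B ≤ h A)
    (hsuper : ∀ A B, h A + h B ≤ h (A ∩ B) + h (A ∪ B)) :
    (k : ℝ) * (h ∅ - h Set.univ) ≤ ∑ i, (h ∅ - h (C i)) := by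
  classical
  have key : ∀ S : Finset N, (k : ℝ) * (h ∅ - h S) ≤ ∑ i, (h ∅ - h (C i ∩ S)) := by
    intro S
    induction S using Finset.induction_on with
    | empty => simp
    | insert j S hj ih =>
      rw [Finset.coe_insert]
      have hd : 0 ≤ h S - h (insert j (S : Set N)) :=
        sub_nonneg.2 (hanti _ _ (Set.subset_insert _ _))
      have hstep : ∀ i, (if j ∈ C i then h S - h (insert j (S : Set N)) else 0) ≤
          h (C i ∩ S) - h (C i ∩ insert j (S : Set N)) := by
        intro i
        split_ifs with hji
        · have h1 : (C i ∩ insert j (S : Set N)) ∩ S = C i ∩ S := by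
            ext x; simp only [Set.mem_inter_iff, Set.mem_insert_iff]; tauto
          have h2 : (C i ∩ insert j (S : Set N)) ∪ S = insert j (S : Set N) := by
            ext x
            simp only [Set.mem_inter_iff, Set.mem_insert_iff, Set.mem_union]
            constructor
            · tauto
            · rintro (rfl | hx) <;> tauto
          have := hsuper (C i ∩ insert j (S : Set N)) S
          rw [h1, h2] at this
          linarith
        · exact sub_nonneg.2 (hanti _ _ (Set.inter_subset_inter_right _ (Set.subset_insert _ _)))
      have hsum := Finset.sum_le_sum fun i (_ : i ∈ Finset.univ) => hstep i
      rw [← Finset.sum_filter, Finset.sum_const, nsmul_eq_mul, Finset.sum_sub_distrib] at hsum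
      have hk : (k : ℝ) ≤ (Finset.univ.filter fun i => j ∈ C i).card := by
        have := hC j
        rw [Set.ncard_eq_toFinset_card'] at this
        simpa using this
      have := mul_le_mul_of_nonneg_right hk hd
      rw [Finset.sum_sub_distrib] at ih ⊢
      linarith
  simpa using key Finset.univ

end Average

/-! ### From oscillation to entropy to tails -/

lemma sub_one_add_exp_neg_le {u : ℝ} (hu : 0 ≤ u) : u - 1 + Real.exp (-u) ≤ u ^ 2 / 2 := by
  have h := Real.quadratic_le_exp_of_nonneg hu
  have hp : 0 < 1 + u + u ^ 2 / 2 := by positivity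
  rw [Real.exp_neg]
  have h2 : (Real.exp u)⁻¹ ≤ (1 + u + u ^ 2 / 2)⁻¹ := inv_anti₀ hp h
  have h3 : (1 + u + u ^ 2 / 2)⁻¹ ≤ 1 - u + u ^ 2 / 2 := by
    rw [inv_le_iff_one_le_mul₀ hp]
    nlinarith [sq_nonneg (u ^ 2)]
  linarith

/-- A random variable of oscillation at most `c` satisfies `Ent (exp G) ≤ c² / 2 * E (exp G)`. -/
lemma entropy_exp_le {X : Type*} [MeasurableSpace X] (P : Measure X) [IsProbabilityMeasure P]
    {G : X → ℝ} (hG : IsBddMeas G) {c : ℝ} (hc : ∀ x y, G x - G y ≤ c) :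
    ∫ x, Real.exp (G x) * G x ∂P - (∫ x, Real.exp (G x) ∂P) * Real.log (∫ x, Real.exp (G x) ∂P) ≤
      c ^ 2 / 2 * ∫ x, Real.exp (G x) ∂P := by
  have : Nonempty X := nonempty_of_isProbabilityMeasure P
  have hbdd : BddBelow (Set.range G) := by
    obtain ⟨K, hK⟩ := hG.2
    exact ⟨-K, by rintro _ ⟨x, rfl⟩; exact (abs_le.1 (hK x)).1⟩
  obtain ⟨a, ha, hac⟩ : ∃ a, (∀ x, a ≤ G x) ∧ ∀ x, G x - a ≤ c := by
    refine ⟨⨅ x, G x, fun x => ciInf_le hbdd x, fun x => ?_⟩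
    have : G x - c ≤ ⨅ y, G y := le_ciInf fun y => by linarith [hc x y]
    linarith
  have i1 := hG.exp.isBddMeas.integrable P
  have i2 := (hG.exp.isBddMeas.mul hG).integrable P
  have hpos : 0 < ∫ x, Real.exp (G x) ∂P := integral_exp_pos i1
  -- The entropy is the infimum over `a` of `∫ (exp G * (G - a) - exp G + exp a)`.
  have hlog := sub_le_mul_log_sub_log hpos (Real.exp_pos a)
  rw [Real.log_exp] at hlog
  have key := integral_mono (μ := P) (i2.sub (i1.mul_const (a + 1)))
    ((i1.const_mul (c ^ 2 / 2)).sub (integrable_const (Real.exp a))) fun x => by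
      have hu : 0 ≤ G x - a := sub_nonneg.2 (ha x)
      have h1 := sub_one_add_exp_neg_le hu
      have h2 : (G x - a) ^ 2 / 2 ≤ c ^ 2 / 2 := by
        have := pow_le_pow_left₀ hu (hac x) 2
        linarith
      have h3 := mul_le_mul_of_nonneg_left (h1.trans h2) (Real.exp_pos (G x)).le
      have h4 : Real.exp (G x) * Real.exp (-(G x - a)) = Real.exp a := by
        rw [← Real.exp_add]; ring_nf
      simp only [Pi.sub_apply]
      linarith
  rw [integral_sub' i2 (i1.mul_const _), integral_sub' (i1.const_mul _) (integrable_const _),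
    integral_mul_const, integral_const_mul, integral_const] at key
  simp only [probReal_univ, one_smul] at key
  linarith

/-- Herbst's argument: the entropy bound says that `(log E exp (t f)) / t - V t / 2` is
nonincreasing in `t > 0`, and its limit at `0` is `E f`. -/
lemma cgf_le_of_entropy_le {X : Type*} [MeasurableSpace X] (P : Measure X) [IsProbabilityMeasure P]
    {f : X → ℝ} (hf : IsBddMeas f) {V : ℝ}
    (hEnt : ∀ t : ℝ, 0 < t →
      ∫ x, Real.exp (t * f x) * (t * f x) ∂P - mgf f P t * Real.log (mgf f P t) ≤
        t ^ 2 * V / 2 * mgf f P t) {t : ℝ} (ht : 0 < t) :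
    cgf f P t ≤ t * (∫ x, f x ∂P) + t ^ 2 * V / 2 := by
  have hbm : ∀ s, IsBddMeas (fun x => s * f x) := fun s =>
    IsBddMeas.mul ⟨measurable_const, |s|, fun _ => le_rfl⟩ hf
  have hint : ∀ s, Integrable (fun x => Real.exp (s * f x)) P :=
    fun s => (hbm s).exp.isBddMeas.integrable P
  have hset : integrableExpSet f P = Set.univ := Set.eq_univ_of_forall hint
  have hmem : ∀ s, s ∈ interior (integrableExpSet f P) := by simp [hset]
  have hder : ∀ s, HasDerivAt (cgf f P) (P[fun x => f x * Real.exp (s * f x)] / mgf f P s) s := by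
    intro s
    exact (hasDerivAt_mgf (hmem s)).log (mgf_pos (hint s)).ne'
  set h : ℝ → ℝ := fun s => cgf f P s / s - V * s / 2 with hh
  have hdh : ∀ s, 0 < s → HasDerivAt h
      ((P[fun x => f x * Real.exp (s * f x)] / mgf f P s * s - cgf f P s * 1) / s ^ 2 - V * 1 / 2)
      s := fun s hs =>
    ((hder s).div (hasDerivAt_id s) hs.ne').sub (((hasDerivAt_id s).const_mul V).div_const 2)
  have hanti : AntitoneOn h (Set.Ioi 0) := by
    refine antitoneOn_of_deriv_nonpos (convex_Ioi 0)
      (fun s hs => (hdh s hs).continuousAt.continuousWithinAt) ?_ ?_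
    · rw [interior_Ioi]
      exact fun s hs => (hdh s hs).differentiableAt.differentiableWithinAt
    · rw [interior_Ioi]
      intro s hs
      have hs' : 0 < s := hs
      rw [(hdh s hs).deriv]
      have hM := mgf_pos (hint s)
      have he := hEnt s hs
      have h1 : ∫ x, Real.exp (s * f x) * (s * f x) ∂P =
          s * ∫ x, f x * Real.exp (s * f x) ∂P := by
        rw [← integral_const_mul]
        exact integral_congr_ae (ae_of_all _ fun x => by ring)
      rw [h1] at he
      have h2 : (∫ x, f x * Real.exp (s * f x) ∂P) / mgf f P s * s - cgf f P s ≤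
          s ^ 2 * V / 2 := by
        rw [cgf, ← mul_le_mul_iff_of_pos_left hM]
        have h3 : mgf f P s * ((∫ x, f x * Real.exp (s * f x) ∂P) / mgf f P s * s -
          Real.log (mgf f P s)) = s * (∫ x, f x * Real.exp (s * f x) ∂P) -
            mgf f P s * Real.log (mgf f P s) := by
          generalize (∫ x, f x * Real.exp (s * f x) ∂P) = J
          field_simp
        rw [h3]
        linarith
      rw [sub_nonpos, div_le_iff₀ (by positivity)]
      linarith
  have hlim : Tendsto h (𝓝[>] 0) (𝓝 (∫ x, f x ∂P)) := by
    have h0 := (hder 0)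
    simp only [zero_mul, Real.exp_zero, mul_one, mgf_zero, div_one] at h0
    have h1 := (hasDerivAt_iff_tendsto_slope.1 h0).mono_left
      (nhdsWithin_mono 0 (fun s (hs : 0 < s) => hs.ne'))
    have h2 : Tendsto (fun s : ℝ => V * s / 2) (𝓝[>] 0) (𝓝 0) := by
      have : Continuous (fun s : ℝ => V * s / 2) := by fun_prop
      simpa using (this.tendsto 0).mono_left nhdsWithin_le_nhds
    have h3 := h1.sub h2
    rw [sub_zero] at h3
    refine h3.congr fun s => ?_
    simp [h, slope_def_field]
  have hle : h t ≤ ∫ x, f x ∂P := by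
    refine ge_of_tendsto hlim ?_
    filter_upwards [Ioo_mem_nhdsGT ht] with s hs
    exact hanti hs.1 ht hs.2.le
  simp only [hh] at hle
  have h5 : cgf f P t / t ≤ ∫ x, f x ∂P + V * t / 2 := by linarith
  rw [div_le_iff₀ ht] at h5
  linarith

/-- Chernoff's bound, with the optimal parameter `r / V`. -/
lemma measureReal_ge_le_of_cgf_le {X : Type*} [MeasurableSpace X] (P : Measure X)
    [IsProbabilityMeasure P] {f : X → ℝ} (hf : IsBddMeas f) {V : ℝ} (hV : 0 < V)
    (hcgf : ∀ t : ℝ, 0 < t → cgf f P t ≤ t * (∫ x, f x ∂P) + t ^ 2 * V / 2) {r : ℝ} (hr : 0 < r) :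
    P.real {x | r ≤ f x - ∫ y, f y ∂P} ≤ Real.exp (-(r ^ 2 / (2 * V))) := by
  have ht : 0 < r / V := div_pos hr hV
  have hint : Integrable (fun x => Real.exp (r / V * f x)) P :=
    (IsBddMeas.mul ⟨measurable_const, |r / V|, fun _ => le_rfl⟩ hf).exp.isBddMeas.integrable P
  have h := measure_ge_le_exp_cgf (μ := P) (X := f) (r + ∫ y, f y ∂P) ht.le hint
  have hs : {x | r ≤ f x - ∫ y, f y ∂P} = {x | r + ∫ y, f y ∂P ≤ f x} := by
    ext x
    exact le_sub_iff_add_le (a := r)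
  rw [hs]
  refine h.trans (Real.exp_le_exp.2 ?_)
  have h2 := hcgf _ ht
  have h3 : (r / V) ^ 2 * V / 2 - r / V * r = -(r ^ 2 / (2 * V)) := by
    field_simp
    ring
  linarith

/-! ### The covering pseudo-metric -/

section Covering

variable {N : Type*} {m : ℕ} {C : Fin m → Set N} {w : Fin m → ℝ} {Ω : N → Type*}

lemma coveringDist_le_sum (hw : ∀ i, 0 ≤ w i) {x y : ∀ j, Ω j} (I : Finset (Fin m))
    (hI : {j : N | x j ≠ y j} ⊆ ⋃ i ∈ I, C i) : coveringDist C w x y ≤ ∑ i ∈ I, w i := by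
  refine csInf_le ⟨0, ?_⟩ ⟨I, hI, rfl⟩
  rintro _ ⟨J, -, rfl⟩
  exact Finset.sum_nonneg fun i _ => hw i

lemma IsKCover.coveringDist_le {k : ℕ} (hk : 1 ≤ k) (hC : IsKCover k C) (hw : ∀ i, 0 ≤ w i)
    (x y : ∀ j, Ω j) : coveringDist C w x y ≤ ∑ i, w i := by
  refine coveringDist_le_sum hw Finset.univ fun j _ => ?_
  obtain ⟨i, hi⟩ := Set.nonempty_of_ncard_ne_zero (Nat.one_le_iff_ne_zero.1 (hk.trans (hC j)))
  exact Set.mem_iUnion₂.2 ⟨i, Finset.mem_univ i, hi⟩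

open Classical in
lemma coveringDist_piecewise_le (hw : ∀ i, 0 ≤ w i) (i : Fin m) (x y z : ∀ j, Ω j) :
    coveringDist C w ((C i).piecewise y x) ((C i).piecewise z x) ≤ w i := by
  refine (coveringDist_le_sum hw {i} fun j hj => ?_).trans_eq (Finset.sum_singleton _ _)
  by_contra h
  simp only [Finset.mem_singleton, Set.iUnion_iUnion_eq_left] at h
  simp [h] at hj

variable [Fintype N] [∀ j, MeasurableSpace (Ω j)] (μ : ∀ j, Measure (Ω j))
  [∀ j, IsProbabilityMeasure (μ j)]

open Classical in
/-- If resampling the coordinates in `A` changes `g` by at most `c`, then the entropy of `exp g`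
over these coordinates is on average at most `c² / 2 * E (exp g)`. -/
lemma averageEntropy_exp_sub_le {g : (∀ j, Ω j) → ℝ} (hg : IsBddMeas g) {A : Set N} {c : ℝ}
    (hc : ∀ x y z, g (A.piecewise y x) - g (A.piecewise z x) ≤ c) :
    averageEntropy μ (fun x => Real.exp (g x)) ∅ - averageEntropy μ (fun x => Real.exp (g x)) A ≤
      c ^ 2 / 2 * ∫ x, Real.exp (g x) ∂(Measure.pi μ) := by
  have hF := hg.exp
  have hA := hF.coordAverage μ A
  have hb := hF.isBddMeas.mul hg
  have i1 : Integrable (coordAverage μ A fun x => Real.exp (g x) * g x) (Measure.pi μ) := by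
    refine ((hb.comp (measurable_piecewise_prod A)).integrable
      ((Measure.pi μ).prod (Measure.pi μ))).integral_prod_left
  have i2 := (hA.isBddMeas.mul hA.log).integrable (Measure.pi μ)
  have key := integral_mono (μ := Measure.pi μ) (i1.sub i2)
    ((hA.isBddMeas.integrable (Measure.pi μ)).const_mul (c ^ 2 / 2)) fun x =>
      entropy_exp_le (Measure.pi μ) (hg.comp (measurable_piecewise_left A x)) (hc x)
  rw [integral_sub' i1 i2, integral_const_mul, integral_coordAverage μ hF.isBddMeas,
    integral_coordAverage μ hb] at key
  simpa only [averageEntropy, coordAverage_empty, Real.log_exp] using key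

/-- Shearer's inequality turns the entropy bounds on the blocks into a bound on the product. -/
lemma IsKCover.entropy_exp_le {k : ℕ} (hk : 1 ≤ k) (hC : IsKCover k C) (hw : ∀ i, 0 ≤ w i)
    {f : (∀ j, Ω j) → ℝ} (hf : IsBddMeas f) (hLip : ∀ x y, |f x - f y| ≤ coveringDist C w x y)
    {t : ℝ} (ht : 0 < t) :
    ∫ x, Real.exp (t * f x) * (t * f x) ∂(Measure.pi μ) -
        mgf f (Measure.pi μ) t * Real.log (mgf f (Measure.pi μ) t) ≤
      t ^ 2 * ((∑ i, w i ^ 2) / k) / 2 * mgf f (Measure.pi μ) t := by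
  have hg : IsBddMeas (fun x => t * f x) :=
    IsBddMeas.mul ⟨measurable_const, |t|, fun _ => le_rfl⟩ hf
  have hsh := hC.mul_sub_le_sum (h := averageEntropy μ fun x => Real.exp (t * f x))
    (fun A B => averageEntropy_anti μ hg.exp) (averageEntropy_supermodular μ hg.exp)
  have hblock := Finset.sum_le_sum fun i (_ : i ∈ Finset.univ) =>
    averageEntropy_exp_sub_le μ hg (A := C i) (c := t * w i) fun x y z => by
      rw [← mul_sub]
      exact mul_le_mul_of_nonneg_left ((le_abs_self _).trans
        ((hLip _ _).trans (coveringDist_piecewise_le hw i x y z))) ht.le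
  have hkpos : (0 : ℝ) < k := by exact_mod_cast hk
  have htot := hsh.trans hblock
  have he : averageEntropy μ (fun x => Real.exp (t * f x)) ∅ =
      ∫ x, Real.exp (t * f x) * (t * f x) ∂(Measure.pi μ) := by
    simp only [averageEntropy, coordAverage_empty, Real.log_exp]
  have hu : averageEntropy μ (fun x => Real.exp (t * f x)) Set.univ =
      mgf f (Measure.pi μ) t * Real.log (mgf f (Measure.pi μ) t) := by
    simp [averageEntropy, coordAverage_univ, mgf]
  rw [he, hu, ← Finset.sum_mul, mul_comm, ← le_div_iff₀ hkpos] at htot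
  refine htot.trans_eq ?_
  simp only [mul_pow, mgf, ← Finset.sum_div, ← Finset.mul_sum]
  field_simp

end Covering

theorem theorem3p9 {N : Type*} [Fintype N] [Nonempty N]
    (k m : ℕ) (hk : 1 ≤ k) (hm : 1 ≤ m)
    (C : Fin m → Set N) (hC : IsKCover k C)
    (w : Fin m → ℝ) (hw : ∀ i, 0 ≤ w i)
    {Ω : N → Type*} [∀ j, MeasurableSpace (Ω j)] [∀ j, StandardBorelSpace (Ω j)]
    (μ : ∀ j, MeasureTheory.Measure (Ω j)) [∀ j, MeasureTheory.IsProbabilityMeasure (μ j)]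
    (f : (∀ j, Ω j) → ℝ) (hf : Measurable f)
    (hLip : ∀ x y, |f x - f y| ≤ coveringDist C w x y) :
    MeasureTheory.Integrable f (MeasureTheory.Measure.pi μ) ∧
    ∀ r : ℝ, 0 < r →
      (w ≠ 0 →
        (MeasureTheory.Measure.pi μ).real
            {x | r ≤ f x - ∫ y, f y ∂(MeasureTheory.Measure.pi μ)} ≤
          Real.exp (-((k : ℝ) * r ^ 2 / (4 * ∑ i, w i ^ 2)))) ∧
      (w = 0 →
        (MeasureTheory.Measure.pi μ).real
            {x | r ≤ f x - ∫ y, f y ∂(MeasureTheory.Measure.pi μ)} = 0) := by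
  have hb : IsBddMeas f := by
    obtain ⟨x₀⟩ := nonempty_of_isProbabilityMeasure (Measure.pi μ)
    refine ⟨hf, ∑ i, w i + |f x₀|, fun x => ?_⟩
    have h1 := (hLip x x₀).trans (hC.coveringDist_le hk hw x x₀)
    have h2 := abs_sub_abs_le_abs_sub (f x) (f x₀)
    linarith
  have hkpos : (0 : ℝ) < k := by exact_mod_cast hk
  refine ⟨hb.integrable _, fun r hr => ⟨fun hw0 => ?_, fun hw0 => ?_⟩⟩
  · have hS : 0 < ∑ i, w i ^ 2 := by
      obtain ⟨i, hi⟩ := Function.ne_iff.1 hw0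
      exact Finset.sum_pos' (fun i _ => sq_nonneg _) ⟨i, Finset.mem_univ i, sq_pos_of_ne_zero hi⟩
    refine (measureReal_ge_le_of_cgf_le (Measure.pi μ) hb (div_pos hS hkpos) (fun t ht =>
      cgf_le_of_entropy_le (Measure.pi μ) hb
        (fun s hs => hC.entropy_exp_le μ hk hw hb hLip hs) ht) hr).trans (Real.exp_le_exp.2 ?_)
    -- The bound obtained is `exp (-(k * r ^ 2 / (2 * ∑ i, w i ^ 2)))`.
    rw [neg_le_neg_iff, ← mul_div_assoc, div_div_eq_mul_div, mul_comm (r ^ 2)]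
    exact div_le_div_of_nonneg_left (by positivity) (by positivity) (by linarith)
  · have hconst : ∀ x y, f x = f y := fun x y => by
      have h := (hLip x y).trans (hC.coveringDist_le hk hw x y)
      simp only [hw0, Pi.zero_apply, Finset.sum_const_zero] at h
      exact sub_eq_zero.1 (abs_nonpos_iff.1 h)
    have hempty : {x | r ≤ f x - ∫ y, f y ∂(Measure.pi μ)} = ∅ := by
      refine Set.eq_empty_of_forall_notMem fun x hx => ?_
      have hint : ∫ y, f y ∂(Measure.pi μ) = f x := by
        simp [fun y => hconst y x]
      rw [Set.mem_ofPred_eq, hint, sub_self] at hx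
      exact hr.not_ge hx
    rw [hempty, measureReal_empty]
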